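/- **Definitions.** $C_{l,Lip}(\mathbb{R}^n)$ is the set of functions $\varphi:\mathbb{R}^n\to\mathbb{R}$ such that $|\varphi(x)-\varphi(y)|\le C(1+|x|^m+|y|^m)|x-y|$ for all $x,y$, for some $C>0$ and $m\in\mathbb{N}$. A *sublinear expectation space* $(\Omega,\mathcal{H},\mathbb{E})$ consists of a measurable space $\Omega$, a set $\mathcal{H}$ of real random variables on $\Omega$ containing the constants and such that $\varphi(Z_1,\dots,Z_n)\in\mathcal{H}$ whenever $Z_1,\dots,Z_n\in\mathcal{H}$ and $\varphi\in C_{l,Lip}(\mathbb{R}^n)$, and a functional $\mathbb{E}:\mathcal{H}\to\mathbb{R}$ that is monotone, constant preserving, sub-additive and positively homogeneous. A $d$-dimensional random vector is a map $\Omega\to\mathbb{R}^d$ with all coordinates in $\mathcal{H}$. Two $d$-dimensional random vectors $X,X'$, possibly on different sublinear expectation spaces with expectations $\mathbb{E},\mathbb{E}'$, are *identically distributed* if $\mathbb{E}[\varphi(X)]=\mathbb{E}'[\varphi(X')]$ for all $\varphi\in C_{l,Lip}(\mathbb{R}^d)$. A sequence $(X_i)_{i\ge1}$ of $d$-dimensional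 random vectors is *convolutionary* if for all $1\le k\le n$ and all $\varphi\in C_{l,Lip}(\mathbb{R}^d)$, writing $S_{k,n}=\sum_{i=k}^nX_i$, $$\mathbb{E}[\varphi(S_{k,n}+X_{n+1})]=\mathbb{E}\big[\mathbb{E}[\varphi(x+X_{n+1})]_{x=S_{k,n}}\big].$$ A $d$-dimensional random vector $\eta$ on a sublinear expectation space $(\Omega',\mathcal{H}',\mathbb{E}')$ is *maximally distributed* if there is a bounded, closed, convex $\Gamma\subset\mathbb{R}^d$ such that $\mathbb{E}'[\varphi(\eta)]=\max_{x\in\Gamma}\varphi(x)$ for all $\varphi\in C_{l,Lip}(\mathbb{R}^d)$; it is *characterized by* $G:\mathbb{R}^d\to\mathbb{R}$ if $\mathbb{E}'[\langle p,\eta\rangle]=G(p)$ for all $p\in\mathbb{R}^d$. A function $f:\Omega\to\mathbb{R}$ *belongs to the completion* of $\mathcal{H}$ if for every $\varepsilon>0$ there are $g,h\in\mathcal{H}$ with $|f-g|\le h$ and $\mathbb{E}[h]\le\varepsilon$; then $\mathbb{E}[f]:=\inf\{\mathbb{E}[g]:g\in\mathcal{H},\,g\ge f\}$, which is the unique value with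 $|\mathbb{E}[f]-\mathbb{E}[g]|\le\mathbb{E}[h]$ for all such $g,h$, and is the given value if $f\in\mathcal{H}$. **Theorem (weak law of large numbers).** Let $(X_i)_{i\ge1}$ be a convolutionary sequence of identically distributed $d$-dimensional random vectors on a sublinear expectation space $(\Omega,\mathcal{H},\mathbb{E})$ (so that $\mathbb{E}[|X_1|^2]<\infty$, since $|X_1|^2\in\mathcal{H}$ and $\mathbb{E}$ is real-valued). Put $S_n=\sum_{i=1}^nX_i$ and $G(p)=\mathbb{E}[\langle p,X_1\rangle]$ for $p\in\mathbb{R}^d$. Then there is a maximally distributed random vector, on a suitable sublinear expectation space over $\mathbb{R}^d$, characterized by $G$. Moreover, for every maximally distributed random vector $\eta$ characterized by $G$, on an arbitrary sublinear expectation space $(\Omega',\mathcal{H}',\mathbb{E}')$, and every continuous $\varphi:\mathbb{R}^d\to\mathbb{R}$ with $|\varphi(x)|\le C(1+|x|)$ for some $C$ and all $x$, the functions $\varphi(S_n/n)$ and $\varphi(\eta)$ belong to the completions of $\mathcal{H}$ and $\mathcal{H}'$ respectively, and $$\lim_{n\to\infty}\mathbb{E}\Big[\varphi\Big(\frac{S_n}{n}\Big)\Big]=\mathbb{E}'[\varphi(\eta)].$$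 -/

import Mathlib

open Filter Topology

universe u v

/-- `C_{l,Lip}(V)`: the functions `φ` with
`|φ x - φ y| ≤ C (1 + |x|^m + |y|^m) |x - y|` for some `C > 0` and `m ∈ ℕ`. -/
def LocLip {V : Type*} [NormedAddCommGroup V] (φ : V → ℝ) : Prop :=
  ∃ C : ℝ, 0 < C ∧ ∃ m : ℕ, ∀ x y : V,
    |φ x - φ y| ≤ C * (1 + ‖x‖ ^ m + ‖y‖ ^ m) * ‖x - y‖

/-- A sublinear expectation space `(Ω, H, E)` over a measurable space `Ω`.
`H` is a set of random variables that is stable under `C_{l,Lip}` functions of finitely many of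
its elements (the case `n = 0` says that constants are in `H`). `E` is a real-valued functional
on `H`; it is represented by a total function of which only the values on `H` matter. -/
structure SublinearExpectation (Ω : Type u) [MeasurableSpace Ω] where
  H : Set (Ω → ℝ)
  E : (Ω → ℝ) → ℝ
  measurable_of_mem : ∀ X ∈ H, Measurable X
  comp_mem : ∀ (n : ℕ) (X : Fin n → Ω → ℝ), (∀ i, X i ∈ H) →
    ∀ φ : EuclideanSpace ℝ (Fin n) → ℝ, LocLip φ →
      (fun ω => φ (WithLp.toLp 2 (fun i => X i ω))) ∈ H
  mono : ∀ X ∈ H, ∀ Y ∈ H, (∀ ω, Y ω ≤ X ω) → E Y ≤ E X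
  const : ∀ c : ℝ, E (fun _ => c) = c
  subadd : ∀ X ∈ H, ∀ Y ∈ H, E (fun ω => X ω + Y ω) ≤ E X + E Y
  posHom : ∀ c : ℝ, 0 ≤ c → ∀ X ∈ H, E (fun ω => c * X ω) = c * E X

/-- A `d`-dimensional random vector: all coordinates belong to `H`. -/
def SublinearExpectation.IsRandomVector {Ω : Type u} [MeasurableSpace Ω]
    (S : SublinearExpectation Ω) {d : ℕ} (X : Ω → EuclideanSpace ℝ (Fin d)) : Prop :=
  ∀ i : Fin d, (fun ω => X ω i) ∈ S.H

/-- `X₁` on `(Ω₁, H₁, E₁)` and `X₂` on `(Ω₂, H₂, E₂)` are identically distributed. -/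
def IdentDistributed {Ω₁ : Type u} [MeasurableSpace Ω₁] {Ω₂ : Type v} [MeasurableSpace Ω₂]
    (S₁ : SublinearExpectation Ω₁) (S₂ : SublinearExpectation Ω₂) {d : ℕ}
    (X₁ : Ω₁ → EuclideanSpace ℝ (Fin d)) (X₂ : Ω₂ → EuclideanSpace ℝ (Fin d)) : Prop :=
  ∀ φ : EuclideanSpace ℝ (Fin d) → ℝ, LocLip φ →
    S₁.E (fun ω => φ (X₁ ω)) = S₂.E (fun ω => φ (X₂ ω))

/-- `Y` and `X` are of convolution: `E[φ(X + Y)] = E[E[φ(x + Y)]_{x = X}]`. -/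
def SublinearExpectation.IsConvolution {Ω : Type u} [MeasurableSpace Ω]
    (S : SublinearExpectation Ω) {d : ℕ} (Y X : Ω → EuclideanSpace ℝ (Fin d)) : Prop :=
  ∀ φ : EuclideanSpace ℝ (Fin d) → ℝ, LocLip φ →
    S.E (fun ω => φ (X ω + Y ω)) = S.E (fun ω => S.E (fun ω' => φ (X ω + Y ω')))

/-- A convolutionary sequence, indexed from `0`: for all `k ≤ n`, the vectors `X (n + 1)` and
`X k + ⋯ + X n` are of convolution, i.e.
`E[φ(X k + ⋯ + X (n + 1))] = E[E[φ(x + X (n + 1))]_{x = X k + ⋯ + X n}]`. -/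
def SublinearExpectation.IsConvolutionary {Ω : Type u} [MeasurableSpace Ω]
    (S : SublinearExpectation Ω) {d : ℕ} (X : ℕ → Ω → EuclideanSpace ℝ (Fin d)) : Prop :=
  ∀ n k : ℕ, k ≤ n →
    S.IsConvolution (X (n + 1)) (fun ω => ∑ i ∈ Finset.Icc k n, X i ω)

/-- `η` is maximally distributed: for some bounded, closed and convex `Γ ⊆ ℝ^d`, for every
`φ ∈ C_{l,Lip}(ℝ^d)`, the maximum of `φ` over `Γ` exists and equals `E[φ(η)]`. -/
def SublinearExpectation.IsMaximal {Ω : Type u} [MeasurableSpace Ω]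
    (S : SublinearExpectation Ω) {d : ℕ} (η : Ω → EuclideanSpace ℝ (Fin d)) : Prop :=
  ∃ Γ : Set (EuclideanSpace ℝ (Fin d)), Bornology.IsBounded Γ ∧ IsClosed Γ ∧ Convex ℝ Γ ∧
    ∀ φ : EuclideanSpace ℝ (Fin d) → ℝ, LocLip φ →
      IsGreatest (φ '' Γ) (S.E (fun ω => φ (η ω)))

/-- `f` belongs to the completion of `H` with respect to `E[|·|]`: for every `ε > 0` there are
`g, h ∈ H` with `|f - g| ≤ h` and `E[h] ≤ ε`. -/
def SublinearExpectation.InCompletion {Ω : Type u} [MeasurableSpace Ω]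
    (S : SublinearExpectation Ω) (f : Ω → ℝ) : Prop :=
  ∀ ε : ℝ, 0 < ε → ∃ g ∈ S.H, ∃ h ∈ S.H, (∀ ω, |f ω - g ω| ≤ h ω) ∧ S.E h ≤ ε

/-- The extension of `E` from `H` to its completion, written as an upper expectation. It agrees
with `E` on `H` (`expect_of_mem`), and on the completion it is the limit of `E[g]` along every
approximation of `f` by elements `g` of `H` (`abs_expect_sub_le`). -/
noncomputable def SublinearExpectation.expect {Ω : Type u} [MeasurableSpace Ω]
    (S : SublinearExpectation Ω) (f : Ω → ℝ) : ℝ :=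
  sInf {a : ℝ | ∃ g ∈ S.H, (∀ ω, f ω ≤ g ω) ∧ a = S.E g}

section Facts

variable {Ω : Type u} [MeasurableSpace Ω] (S : SublinearExpectation Ω)

theorem SublinearExpectation.comp_vec_mem {d : ℕ} {X : Ω → EuclideanSpace ℝ (Fin d)}
    (hX : S.IsRandomVector X) {φ : EuclideanSpace ℝ (Fin d) → ℝ} (hφ : LocLip φ) :
    (fun ω => φ (X ω)) ∈ S.H :=
  S.comp_mem d (fun i ω => X ω i) hX φ hφ

theorem SublinearExpectation.const_mem (c : ℝ) : (fun _ : Ω => c) ∈ S.H :=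
  S.comp_mem 0 (fun i => i.elim0) (fun i => i.elim0) (fun _ => c)
    ⟨1, one_pos, 0, fun x y => by simp; positivity⟩

theorem SublinearExpectation.add_mem {f g : Ω → ℝ} (hf : f ∈ S.H) (hg : g ∈ S.H) :
    (fun ω => f ω + g ω) ∈ S.H := by
  have h := S.comp_mem 2 ![f, g] (by intro i; fin_cases i <;> simpa)
    (fun x => x 0 + x 1) ⟨2, two_pos, 0, fun x y => by
      have h0 : |x 0 - y 0| ≤ ‖x - y‖ := by
        simpa using PiLp.norm_apply_le (x - y) 0
      have h1 : |x 1 - y 1| ≤ ‖x - y‖ := by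
        simpa using PiLp.norm_apply_le (x - y) 1
      have h2 : x 0 + x 1 - (y 0 + y 1) = (x 0 - y 0) + (x 1 - y 1) := by ring
      have h3 := abs_add_le (x 0 - y 0) (x 1 - y 1)
      have h4 := norm_nonneg (x - y)
      rw [h2]
      simp only [pow_zero]
      linarith⟩
  simpa using h

theorem SublinearExpectation.smul_mem (c : ℝ) {f : Ω → ℝ} (hf : f ∈ S.H) :
    (fun ω => c * f ω) ∈ S.H := by
  have h := S.comp_mem 1 ![f] (by intro i; fin_cases i; simpa)
    (fun x => c * x 0) ⟨|c| + 1, by positivity, 0, fun x y => by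
      have h0 : |x 0 - y 0| ≤ ‖x - y‖ := by
        simpa using PiLp.norm_apply_le (x - y) 0
      have h4 := norm_nonneg (x - y)
      have h5 : |c| * |x 0 - y 0| ≤ |c| * ‖x - y‖ := by gcongr
      have h6 : 0 ≤ |c| * ‖x - y‖ := by positivity
      rw [← mul_sub, abs_mul]
      simp only [pow_zero]
      nlinarith⟩
  simpa using h

theorem SublinearExpectation.expect_of_mem {f : Ω → ℝ} (hf : f ∈ S.H) :
    S.expect f = S.E f := by
  refine IsLeast.csInf_eq ⟨⟨f, hf, fun _ => le_rfl, rfl⟩, ?_⟩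
  rintro a ⟨g, hg, hfg, rfl⟩
  exact S.mono g hg f hf hfg

theorem SublinearExpectation.abs_expect_sub_le {f g h : Ω → ℝ}
    (hg : g ∈ S.H) (hh : h ∈ S.H) (hfg : ∀ ω, |f ω - g ω| ≤ h ω) :
    |S.expect f - S.E g| ≤ S.E h := by
  have hlow : ∀ a ∈ {a : ℝ | ∃ k ∈ S.H, (∀ ω, f ω ≤ k ω) ∧ a = S.E k}, S.E g - S.E h ≤ a := by
    rintro a ⟨k, hk, hfk, rfl⟩
    have h1 := S.mono _ (S.add_mem hk hh) g hg (fun ω => by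
      have := (abs_le.mp (hfg ω)).1
      have := hfk ω
      linarith)
    have h2 := S.subadd k hk h hh
    linarith
  have hmem : S.E (fun ω => g ω + h ω) ∈
      {a : ℝ | ∃ k ∈ S.H, (∀ ω, f ω ≤ k ω) ∧ a = S.E k} :=
    ⟨_, S.add_mem hg hh, fun ω => by
      have := (abs_le.mp (hfg ω)).2
      linarith, rfl⟩
  have h1 : S.E g - S.E h ≤ S.expect f := le_csInf ⟨_, hmem⟩ hlow
  have h2 : S.expect f ≤ S.E (fun ω => g ω + h ω) := csInf_le ⟨_, hlow⟩ hmem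
  have h3 := S.subadd g hg h hh
  rw [abs_le]
  constructor <;> linarith

theorem LocLip.norm_pow {V : Type*} [NormedAddCommGroup V] (m : ℕ) :
    LocLip (fun x : V => ‖x‖ ^ m) := by
  refine ⟨m + 1, by positivity, m - 1, fun x y => ?_⟩
  have h1 : |‖x‖ - ‖y‖| ≤ ‖x - y‖ := abs_norm_sub_norm_le x y
  have h2 := abs_pow_sub_pow_le ‖x‖ ‖y‖ m
  simp only [abs_norm] at h2
  have h3 : max ‖x‖ ‖y‖ ^ (m - 1) ≤ 1 + ‖x‖ ^ (m - 1) + ‖y‖ ^ (m - 1) := by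
    have hx : 0 ≤ ‖x‖ ^ (m - 1) := by positivity
    have hy : 0 ≤ ‖y‖ ^ (m - 1) := by positivity
    rcases max_choice ‖x‖ ‖y‖ with h | h <;> rw [h] <;> linarith
  calc |‖x‖ ^ m - ‖y‖ ^ m| ≤ |‖x‖ - ‖y‖| * m * max ‖x‖ ‖y‖ ^ (m - 1) := h2
    _ ≤ ‖x - y‖ * (m + 1) * (1 + ‖x‖ ^ (m - 1) + ‖y‖ ^ (m - 1)) := by
        gcongr
        linarith
    _ = _ := by ring

/-- The second moment of a random vector is the (real, hence finite) expectation of an element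
of `H`. -/
theorem SublinearExpectation.norm_sq_mem {d : ℕ} {X : Ω → EuclideanSpace ℝ (Fin d)}
    (hX : S.IsRandomVector X) : (fun ω => ‖X ω‖ ^ 2) ∈ S.H :=
  S.comp_vec_mem hX (LocLip.norm_pow 2)

theorem LocLip.comp_add {V : Type*} [NormedAddCommGroup V] {φ : V → ℝ} (hφ : LocLip φ) (x : V) :
    LocLip (fun y => φ (x + y)) := by
  obtain ⟨C, hC, m, h⟩ := hφ
  refine ⟨C * (1 + 2 ^ (m + 1) * ‖x‖ ^ m + 2 ^ m), by positivity, m, fun y z => ?_⟩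
  have key : ∀ y : V, ‖x + y‖ ^ m ≤ 2 ^ m * (‖x‖ ^ m + ‖y‖ ^ m) := fun y => by
    calc ‖x + y‖ ^ m ≤ (‖x‖ + ‖y‖) ^ m := by gcongr; exact norm_add_le x y
      _ ≤ 2 ^ (m - 1) * (‖x‖ ^ m + ‖y‖ ^ m) :=
        add_pow_le (norm_nonneg x) (norm_nonneg y) m
      _ ≤ 2 ^ m * (‖x‖ ^ m + ‖y‖ ^ m) := by gcongr <;> simp
  have h1 := h (x + y) (x + z)
  rw [add_sub_add_left_eq_sub] at h1
  refine h1.trans ?_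
  rw [mul_assoc C, mul_assoc C, mul_assoc C]
  refine mul_le_mul_of_nonneg_left ?_ hC.le
  refine mul_le_mul_of_nonneg_right ?_ (norm_nonneg _)
  have hy := key y
  have hz := key z
  have a : 0 ≤ ‖x‖ ^ m := by positivity
  have b : 0 ≤ ‖y‖ ^ m := by positivity
  have c : 0 ≤ ‖z‖ ^ m := by positivity
  have e : (0 : ℝ) ≤ 2 ^ m := by positivity
  rw [pow_succ]
  nlinarith [mul_nonneg a b, mul_nonneg a c, mul_nonneg e (mul_nonneg a b),
    mul_nonneg e (mul_nonneg a c)]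

/-- The inner expectation in the definition of convolution is a `C_{l,Lip}` function of `x`, so
that the outer one is again the expectation of an element of `H`. -/
theorem SublinearExpectation.locLip_inner {d : ℕ} {Y : Ω → EuclideanSpace ℝ (Fin d)}
    (hY : S.IsRandomVector Y) {φ : EuclideanSpace ℝ (Fin d) → ℝ} (hφ : LocLip φ) :
    LocLip (fun x => S.E (fun ω => φ (x + Y ω))) := by
  have hmem : ∀ x, (fun ω => φ (x + Y ω)) ∈ S.H := fun x => S.comp_vec_mem hY (hφ.comp_add x)
  obtain ⟨C, hC, m, h⟩ := hφ
  have hM : (fun ω => ‖Y ω‖ ^ m) ∈ S.H := S.comp_vec_mem hY (LocLip.norm_pow m)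
  set M := S.E (fun ω => ‖Y ω‖ ^ m) with hMdef
  have hM0 : 0 ≤ M := by
    have := S.mono _ hM _ (S.const_mem 0) (fun ω => by positivity)
    rwa [S.const] at this
  have key : ∀ x y : EuclideanSpace ℝ (Fin d), ‖x + y‖ ^ m ≤ 2 ^ m * (‖x‖ ^ m + ‖y‖ ^ m) :=
    fun x y => by
    calc ‖x + y‖ ^ m ≤ (‖x‖ + ‖y‖) ^ m := by gcongr; exact norm_add_le x y
      _ ≤ 2 ^ (m - 1) * (‖x‖ ^ m + ‖y‖ ^ m) :=
        add_pow_le (norm_nonneg x) (norm_nonneg y) m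
      _ ≤ 2 ^ m * (‖x‖ ^ m + ‖y‖ ^ m) := by gcongr <;> simp
  have one : ∀ x y, S.E (fun ω => φ (x + Y ω)) ≤ S.E (fun ω => φ (y + Y ω)) +
      (C * (1 + 2 ^ m * (‖x‖ ^ m + ‖y‖ ^ m)) * ‖x - y‖ + C * 2 ^ (m + 1) * ‖x - y‖ * M) := by
    intro x y
    set a := C * (1 + 2 ^ m * (‖x‖ ^ m + ‖y‖ ^ m)) * ‖x - y‖
    set b := C * 2 ^ (m + 1) * ‖x - y‖
    have hb : 0 ≤ b := by positivity
    have hbM := S.smul_mem b hM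
    have hR := S.add_mem (S.const_mem a) hbM
    have h1 := S.mono _ (S.add_mem (hmem y) hR) _ (hmem x) (fun ω => by
      have h2 := h (x + Y ω) (y + Y ω)
      rw [add_sub_add_right_eq_sub] at h2
      have h3 : C * (1 + ‖x + Y ω‖ ^ m + ‖y + Y ω‖ ^ m) * ‖x - y‖ ≤
          C * (1 + 2 ^ m * (‖x‖ ^ m + ‖Y ω‖ ^ m) + 2 ^ m * (‖y‖ ^ m + ‖Y ω‖ ^ m)) * ‖x - y‖ := by
        gcongr
        · exact key x (Y ω)
        · exact key y (Y ω)
      have h4 : C * (1 + 2 ^ m * (‖x‖ ^ m + ‖Y ω‖ ^ m) + 2 ^ m * (‖y‖ ^ m + ‖Y ω‖ ^ m)) * ‖x - y‖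
          = a + b * ‖Y ω‖ ^ m := by
        simp only [a, b]; ring
      have h5 := (abs_le.mp h2).2
      linarith)
    have h2 := S.subadd _ (hmem y) _ hR
    have h3 := S.subadd _ (S.const_mem a) _ hbM
    rw [S.const, S.posHom b hb _ hM] at h3
    linarith
  refine ⟨C * (1 + 2 ^ (m + 1) * M + 2 ^ m), by positivity, m, fun x y => ?_⟩
  have hxy := one x y
  have hyx := one y x
  rw [norm_sub_rev y x, add_comm (‖y‖ ^ m)] at hyx
  have hle : C * (1 + 2 ^ m * (‖x‖ ^ m + ‖y‖ ^ m)) * ‖x - y‖ + C * 2 ^ (m + 1) * ‖x - y‖ * M ≤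
      C * (1 + 2 ^ (m + 1) * M + 2 ^ m) * (1 + ‖x‖ ^ m + ‖y‖ ^ m) * ‖x - y‖ := by
    have h0 : 0 ≤ C * ‖x - y‖ := by positivity
    have h1 : 0 ≤ (2 ^ (m + 1) * M + 1) * (‖x‖ ^ m + ‖y‖ ^ m) + 2 ^ m := by positivity
    nlinarith [mul_nonneg h0 h1]
  rw [abs_le]
  constructor <;> linarith

end Facts

/-! By Hahn-Banach, `G` is the support function of a compact convex set `Γ`, and the maximum over
`Γ` is a maximal distribution characterized by `G`.

For the limit, `S_n` is compared with `n Γ` in mean square. When `X` is added to a point at offset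
`q` from its target, the cross term of the squared distance is linear in `X`, so `G` controls it,
and each step costs only a constant. From above, the target is a nearest point of `k Γ`, moved by a
point of `Γ` that cancels the cross term, so the mean of `dist(S_n, n Γ)^2` is `O(n)`
(`E_infDist_sq_le`). From below, any `v ∈ Γ` is a target and `E[-‖S_n - n v‖^2] ≥ -O(n)`
(`le_E_neg_norm_sq`). Division by `n^2` gives the limit for Lipschitz functions, with a rate
(`abs_E_average_sub_le`).

A continuous `φ` of linear growth is Lipschitz up to `ε (1 + ‖x‖^2)`
(`exists_lipschitzWith_abs_sub_le`). The second moments of `S_n / n` are bounded, so this error is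
uniform in `n`. -/

theorem LocLip.of_lipschitzWith {V : Type*} [NormedAddCommGroup V] {K : NNReal} {g : V → ℝ}
    (hg : LipschitzWith K g) : LocLip g := by
  refine ⟨K + 1, by positivity, 0, fun x y => ?_⟩
  have h := hg.dist_le_mul x y
  rw [Real.dist_eq, dist_eq_norm] at h
  have h0 := norm_nonneg (x - y)
  have hK : (0 : ℝ) ≤ K := K.2
  simp only [pow_zero]
  nlinarith [mul_nonneg hK h0]

theorem LocLip.const_mul_sq_of_lipschitzWith {V : Type*} [NormedAddCommGroup V] {K : NNReal}
    {g : V → ℝ} (hg : LipschitzWith K g) (c : ℝ) : LocLip (fun x => c * g x ^ 2) := by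
  refine ⟨|c| * (K * (2 * |g 0| + K)) + 1, by positivity, 1, fun x y => ?_⟩
  have hK : (0 : ℝ) ≤ K := K.2
  have h : ∀ x y, |g x - g y| ≤ K * ‖x - y‖ := fun x y => by
    have h := hg.dist_le_mul x y
    rwa [Real.dist_eq, dist_eq_norm] at h
  have hgrowth : ∀ x, |g x| ≤ |g 0| + K * ‖x‖ := fun x => by
    have h1 := h x 0
    rw [sub_zero] at h1
    have h2 := abs_add_le (g 0) (g x - g 0)
    rw [add_sub_cancel] at h2
    linarith
  have hsum : |g x + g y| ≤ (2 * |g 0| + K) * (1 + ‖x‖ + ‖y‖) := by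
    have h1 := abs_add_le (g x) (g y)
    have h2 := hgrowth x
    have h3 := hgrowth y
    have h4 : 0 ≤ |g 0| * (‖x‖ + ‖y‖) := by positivity
    nlinarith
  have heq : c * g x ^ 2 - c * g y ^ 2 = c * ((g x - g y) * (g x + g y)) := by ring
  rw [heq, abs_mul, abs_mul, pow_one, pow_one]
  calc |c| * (|g x - g y| * |g x + g y|)
      ≤ |c| * ((K * ‖x - y‖) * ((2 * |g 0| + K) * (1 + ‖x‖ + ‖y‖))) := by
        gcongr
        exact h x y
    _ = |c| * (K * (2 * |g 0| + K)) * (1 + ‖x‖ + ‖y‖) * ‖x - y‖ := by ring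
    _ ≤ _ := by gcongr; linarith

theorem LocLip.infDist_sq {V : Type*} [NormedAddCommGroup V] (s : Set V) :
    LocLip (fun x => Metric.infDist x s ^ 2) := by
  simpa using LocLip.const_mul_sq_of_lipschitzWith (Metric.lipschitz_infDist_pt s) 1

theorem LocLip.neg_norm_sub_sq {V : Type*} [NormedAddCommGroup V] (c : V) :
    LocLip (fun x => -‖x - c‖ ^ 2) := by
  have h : LipschitzWith 1 (fun x => ‖x - c‖) := by
    simpa only [dist_eq_norm] using LipschitzWith.dist_left c
  simpa using LocLip.const_mul_sq_of_lipschitzWith h (-1)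

theorem LocLip.continuous {V : Type*} [NormedAddCommGroup V] {φ : V → ℝ} (hφ : LocLip φ) :
    Continuous φ := by
  obtain ⟨C, -, m, h⟩ := hφ
  rw [continuous_iff_continuousAt]
  intro x
  rw [ContinuousAt, tendsto_iff_norm_sub_tendsto_zero]
  have hc : Continuous (fun y : V => C * (1 + ‖y‖ ^ m + ‖x‖ ^ m) * ‖y - x‖) := by fun_prop
  refine squeeze_zero (fun _ => norm_nonneg _) (fun y => h y x) ?_
  simpa using hc.tendsto x

theorem LocLip.inner_right {V : Type*} [NormedAddCommGroup V] [InnerProductSpace ℝ V] (p : V) :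
    LocLip (fun x : V => inner ℝ p x) :=
  LocLip.of_lipschitzWith (innerSL ℝ p).lipschitz

/-! ### Elementary rules for sublinear expectations. -/

namespace SublinearExpectation

variable {Ω : Type*} [MeasurableSpace Ω] (S : SublinearExpectation Ω)

theorem E_le_const_add_mul {f h : Ω → ℝ} (hf : f ∈ S.H) (hh : h ∈ S.H) {a b : ℝ} (hb : 0 ≤ b)
    (hle : ∀ ω, f ω ≤ a + b * h ω) : S.E f ≤ a + b * S.E h := by
  have hbh := S.smul_mem b hh
  have h1 := S.mono _ (S.add_mem (S.const_mem a) hbh) _ hf hle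
  have h2 := S.subadd _ (S.const_mem a) _ hbh
  rw [S.const, S.posHom b hb _ hh] at h2
  linarith

/-- `E` is not linear, so this is not the negation of the upper bound; instead the constant is moved
to the other side. -/
theorem const_add_mul_le_E {f h : Ω → ℝ} (hf : f ∈ S.H) (hh : h ∈ S.H) {a b : ℝ} (hb : 0 ≤ b)
    (hle : ∀ ω, a + b * h ω ≤ f ω) : a + b * S.E h ≤ S.E f := by
  have h1 := S.E_le_const_add_mul (S.smul_mem b hh) hf (a := -a) zero_le_one
    (fun ω => by have := hle ω; linarith)
  rw [S.posHom b hb _ hh] at h1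
  linarith

theorem E_nonneg {f : Ω → ℝ} (hf : f ∈ S.H) (h0 : ∀ ω, 0 ≤ f ω) : 0 ≤ S.E f := by
  have := S.mono _ hf _ (S.const_mem 0) h0
  rwa [S.const] at this

variable {d : ℕ}

theorem IsRandomVector.sum_range {S : SublinearExpectation Ω}
    {X : ℕ → Ω → EuclideanSpace ℝ (Fin d)} (hX : ∀ i, S.IsRandomVector (X i)) (n : ℕ) :
    S.IsRandomVector (fun ω => ∑ i ∈ Finset.range n, X i ω) := by
  induction n with
  | zero => intro j; simpa using S.const_mem 0
  | succ n ih =>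
    intro j
    have := S.add_mem (ih j) (hX n j)
    simpa [Finset.sum_range_succ] using this

theorem IsRandomVector.const_smul {S : SublinearExpectation Ω}
    {Y : Ω → EuclideanSpace ℝ (Fin d)} (hY : S.IsRandomVector Y) (c : ℝ) :
    S.IsRandomVector (fun ω => c • Y ω) := by
  intro j
  simpa using S.smul_mem c (hY j)

/-! ### Mean square estimates for the partial sums. -/

section Convolutionary

variable {S} {X : ℕ → Ω → EuclideanSpace ℝ (Fin d)}

/-- Convolution freezes the partial sum; the new summand then occurs alone and can be replaced by `X
0`. -/
theorem IsConvolutionary.E_sum_succ (hid : ∀ i, IdentDistributed S S (X i) (X 0))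
    (hconv : S.IsConvolutionary X) {φ : EuclideanSpace ℝ (Fin d) → ℝ} (hφ : LocLip φ) (n : ℕ) :
    S.E (fun ω => φ (∑ i ∈ Finset.range (n + 1), X i ω)) =
      S.E (fun ω => S.E (fun ω' => φ ((∑ i ∈ Finset.range n, X i ω) + X 0 ω'))) := by
  rcases n with _ | m
  -- The empty sum is outside the convolution hypothesis, but here the outer expectation is that of
  -- a constant.
  · simp [S.const]
  · have h := hconv m 0 (Nat.zero_le _) φ hφ
    have hI : Finset.Icc 0 m = Finset.range (m + 1) := by
      ext i; simp
    rw [hI] at h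
    simp only [Finset.sum_range_succ _ (m + 1)]
    rw [h]
    congr 1
    funext ω
    exact hid (m + 1) _ (hφ.comp_add _)

/-- A supermartingale-type induction: the one-step bound is uniform in `x`, so it may be evaluated
at the frozen sum `x = S_n`. -/
theorem IsConvolutionary.E_sum_le (hX : ∀ i, S.IsRandomVector (X i))
    (hid : ∀ i, IdentDistributed S S (X i) (X 0)) (hconv : S.IsConvolutionary X)
    {f : ℕ → EuclideanSpace ℝ (Fin d) → ℝ} (hf : ∀ k, LocLip (f k)) {C : ℝ}
    (hstep : ∀ k x, S.E (fun ω => f (k + 1) (x + X 0 ω)) ≤ f k x + C) (n : ℕ) :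
    S.E (fun ω => f n (∑ i ∈ Finset.range n, X i ω)) ≤ f 0 0 + n * C := by
  induction n with
  | zero => simp [S.const]
  | succ n ih =>
    rw [hconv.E_sum_succ hid (hf (n + 1))]
    have hR := IsRandomVector.sum_range hX n
    have h := S.E_le_const_add_mul
      (S.comp_vec_mem hR (S.locLip_inner (hX 0) (hf (n + 1)))) (S.comp_vec_mem hR (hf n))
      (a := C) zero_le_one (fun ω => by have := hstep n (∑ i ∈ Finset.range n, X i ω); linarith)
    push_cast
    linarith

theorem IsConvolutionary.le_E_sum (hX : ∀ i, S.IsRandomVector (X i))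
    (hid : ∀ i, IdentDistributed S S (X i) (X 0)) (hconv : S.IsConvolutionary X)
    {f : ℕ → EuclideanSpace ℝ (Fin d) → ℝ} (hf : ∀ k, LocLip (f k)) {C : ℝ}
    (hstep : ∀ k x, f k x - C ≤ S.E (fun ω => f (k + 1) (x + X 0 ω))) (n : ℕ) :
    f 0 0 - n * C ≤ S.E (fun ω => f n (∑ i ∈ Finset.range n, X i ω)) := by
  induction n with
  | zero => simp [S.const]
  | succ n ih =>
    rw [hconv.E_sum_succ hid (hf (n + 1))]
    have hR := IsRandomVector.sum_range hX n
    have h := S.const_add_mul_le_E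
      (S.comp_vec_mem hR (S.locLip_inner (hX 0) (hf (n + 1)))) (S.comp_vec_mem hR (hf n))
      (a := -C) zero_le_one (fun ω => by have := hstep n (∑ i ∈ Finset.range n, X i ω); linarith)
    push_cast
    linarith

variable {Γ : Set (EuclideanSpace ℝ (Fin d))} {R : ℝ}

open scoped Pointwise

/-- If `Γ` has support function `p ↦ E⟨p, X 0⟩`, then `S_n` stays within mean square distance
`O(√n)` of `n Γ`. -/
theorem IsConvolutionary.E_infDist_sq_le (hX : ∀ i, S.IsRandomVector (X i))
    (hid : ∀ i, IdentDistributed S S (X i) (X 0)) (hconv : S.IsConvolutionary X)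
    (hcl : IsClosed Γ) (hcvx : Convex ℝ Γ) (hR : ∀ v ∈ Γ, ‖v‖ ≤ R)
    (hG : ∀ p, IsGreatest ((fun v => inner ℝ p v) '' Γ) (S.E (fun ω => inner ℝ p (X 0 ω))))
    (n : ℕ) :
    S.E (fun ω => Metric.infDist (∑ i ∈ Finset.range n, X i ω) ((n : ℝ) • Γ) ^ 2) ≤
      n * (2 * R ^ 2 + 2 * S.E (fun ω => ‖X 0 ω‖ ^ 2)) := by
  have hne : Γ.Nonempty := (hG 0).1.imp fun v hv => hv.1
  have hcpt : IsCompact Γ := Metric.isCompact_of_isClosed_isBounded hcl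
    (isBounded_iff_forall_norm_le.2 ⟨R, hR⟩)
  have hLL : ∀ k : ℕ, LocLip (fun x => Metric.infDist x ((k : ℝ) • Γ) ^ 2) := fun k =>
    LocLip.infDist_sq _
  have h := hconv.E_sum_le hX hid (f := fun k x => Metric.infDist x ((k : ℝ) • Γ) ^ 2) hLL
    (C := 2 * R ^ 2 + 2 * S.E (fun ω => ‖X 0 ω‖ ^ 2)) ?_ n
  · refine h.trans (le_of_eq ?_)
    have h0 : ((0 : ℕ) : ℝ) • Γ = {0} := by
      rw [Nat.cast_zero, Set.zero_smul_set hne]; rfl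
    simp only [h0, Metric.infDist_singleton, dist_self]
    ring
  · intro k x
    obtain ⟨z, hz, hxz⟩ := (hcpt.smul (k : ℝ)).exists_infDist_eq_dist (hne.smul_set) x
    -- This `y` maximizes `⟨x - z, ·⟩` on `Γ`, so `E⟨x - z, X 0⟩ = ⟨x - z, y⟩` and the cross term
    -- vanishes.
    obtain ⟨y, hy, hGy⟩ := (hG (x - z)).1
    -- Convexity enters here, through `k Γ + Γ = (k + 1) Γ`.
    have hsum : z + y ∈ ((k + 1 : ℕ) : ℝ) • Γ := by
      rw [Nat.cast_add, hcvx.add_smul (Nat.cast_nonneg k) (Nat.cast_nonneg 1)]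
      exact Set.add_mem_add hz (by simpa using hy)
    have hin := S.comp_vec_mem (hX 0) (LocLip.inner_right (x - z))
    have hsq := S.norm_sq_mem (hX 0)
    have hle := S.E_le_const_add_mul (S.comp_vec_mem (hX 0) ((hLL (k + 1)).comp_add x))
      (S.add_mem hin hsq) (b := 2)
      (a := Metric.infDist x ((k : ℝ) • Γ) ^ 2 - 2 * inner ℝ (x - z) y + 2 * R ^ 2) zero_le_two ?_
    · have := S.subadd _ hin _ hsq
      simp only at hGy
      linarith
    · intro ω
      have h1 : Metric.infDist (x + X 0 ω) (((k + 1 : ℕ) : ℝ) • Γ) ≤ ‖(x - z) + (X 0 ω - y)‖ := by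
        refine (Metric.infDist_le_dist_of_mem hsum).trans (le_of_eq ?_)
        rw [dist_eq_norm]; congr 1; abel
      have h2 := pow_le_pow_left₀ Metric.infDist_nonneg h1 2
      rw [norm_add_sq_real, inner_sub_right] at h2
      have h3 : ‖X 0 ω - y‖ ^ 2 ≤ 2 * ‖X 0 ω‖ ^ 2 + 2 * R ^ 2 := by
        have h4 := norm_sub_le (X 0 ω) y
        have h5 := hR y hy
        have h6 := norm_nonneg (X 0 ω - y)
        nlinarith [sq_nonneg (‖X 0 ω‖ - R)]
      rw [hxz, dist_eq_norm]
      linarith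

/-- If `v` is dominated by `p ↦ E⟨p, X 0⟩`, then `S_n` can be steered to within mean square
distance `O(√n)` of `n v`. -/
theorem IsConvolutionary.le_E_neg_norm_sq (hX : ∀ i, S.IsRandomVector (X i))
    (hid : ∀ i, IdentDistributed S S (X i) (X 0)) (hconv : S.IsConvolutionary X)
    {v : EuclideanSpace ℝ (Fin d)} (hR : ‖v‖ ≤ R)
    (hG : ∀ p, inner ℝ p v ≤ S.E (fun ω => inner ℝ p (X 0 ω))) (n : ℕ) :
    -(n * (2 * R ^ 2 + 2 * S.E (fun ω => ‖X 0 ω‖ ^ 2))) ≤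
      S.E (fun ω => -‖(∑ i ∈ Finset.range n, X i ω) - (n : ℝ) • v‖ ^ 2) := by
  have hLL : ∀ k : ℕ, LocLip (fun x => -‖x - (k : ℝ) • v‖ ^ 2) := fun k =>
    LocLip.neg_norm_sub_sq _
  have h := hconv.le_E_sum hX hid (f := fun k x => -‖x - (k : ℝ) • v‖ ^ 2) hLL
    (C := 2 * R ^ 2 + 2 * S.E (fun ω => ‖X 0 ω‖ ^ 2)) ?_ n
  · refine le_trans (le_of_eq ?_) h
    simp
  · intro k x
    set q := x - (k : ℝ) • v with hq
    -- The cross term is `2⟨-q, X 0 - v⟩`; domination at `p = -q` makes its expectation nonnegative.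
    have hin := S.comp_vec_mem (hX 0) (LocLip.inner_right (-q))
    have hsq := S.norm_sq_mem (hX 0)
    have hnsq := S.smul_mem (-1) hsq
    have hle := S.const_add_mul_le_E (S.comp_vec_mem (hX 0) ((hLL (k + 1)).comp_add x))
      (S.add_mem hin hnsq) (b := 2)
      (a := -‖q‖ ^ 2 + 2 * inner ℝ q v - 2 * R ^ 2) zero_le_two ?_
    -- Adding `‖X 0‖^2` back and using sub-additivity bounds the expectation of the difference from
    -- below.
    · have h1 := S.subadd _ (S.add_mem hin hnsq) _ hsq
      have h2 := hG (-q)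
      rw [inner_neg_left] at h2
      simp only [neg_one_mul, neg_add_cancel_right] at h1 hle
      linarith
    · intro ω
      have h1 : x + X 0 ω - ((k + 1 : ℕ) : ℝ) • v = q + (X 0 ω - v) := by
        rw [hq, Nat.cast_add, add_smul, Nat.cast_one, one_smul]; abel
      rw [h1, norm_add_sq_real, inner_sub_right, inner_neg_left]
      have h3 : ‖X 0 ω - v‖ ^ 2 ≤ 2 * ‖X 0 ω‖ ^ 2 + 2 * R ^ 2 := by
        have h4 := norm_sub_le (X 0 ω) v
        have h6 := norm_nonneg (X 0 ω - v)
        nlinarith [sq_nonneg (‖X 0 ω‖ - R)]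
      linarith

/-- The average lies within `dist(S_n, n Γ) / n` of a point of norm at most `R`. The bound is
uniform in `n`, as the weight `1 + ‖x‖^2` requires. -/
theorem IsConvolutionary.E_norm_sq_average_le (hX : ∀ i, S.IsRandomVector (X i))
    (hid : ∀ i, IdentDistributed S S (X i) (X 0)) (hconv : S.IsConvolutionary X)
    (hcl : IsClosed Γ) (hcvx : Convex ℝ Γ) (hR : ∀ v ∈ Γ, ‖v‖ ≤ R)
    (hG : ∀ p, IsGreatest ((fun v => inner ℝ p v) '' Γ) (S.E (fun ω => inner ℝ p (X 0 ω))))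
    (n : ℕ) :
    S.E (fun ω => ‖(n : ℝ)⁻¹ • ∑ i ∈ Finset.range n, X i ω‖ ^ 2) ≤
      2 * R ^ 2 + 2 * (2 * R ^ 2 + 2 * S.E (fun ω => ‖X 0 ω‖ ^ 2)) := by
  have hne : Γ.Nonempty := (hG 0).1.imp fun v hv => hv.1
  have hcpt : IsCompact Γ := Metric.isCompact_of_isClosed_isBounded hcl
    (isBounded_iff_forall_norm_le.2 ⟨R, hR⟩)
  have hSn := IsRandomVector.sum_range hX n
  have hC := S.E_nonneg (S.norm_sq_mem (hX 0)) (fun ω => by positivity)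
  rcases Nat.eq_zero_or_pos n with rfl | hn
  · simp only [Nat.cast_zero, inv_zero, zero_smul, norm_zero, S.const]
    nlinarith [sq_nonneg R]
  have hn' : (1 : ℝ) ≤ n := by exact_mod_cast hn
  have hD := hconv.E_infDist_sq_le hX hid hcl hcvx hR hG n
  set C := 2 * R ^ 2 + 2 * S.E (fun ω => ‖X 0 ω‖ ^ 2)
  have hC0 : 0 ≤ C := by positivity
  have hdm : (fun ω => Metric.infDist (∑ i ∈ Finset.range n, X i ω) ((n : ℝ) • Γ) ^ 2) ∈ S.H :=
    S.comp_vec_mem hSn (LocLip.infDist_sq _)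
  have hle := S.E_le_const_add_mul (S.norm_sq_mem (hSn.const_smul (n : ℝ)⁻¹)) hdm (a := 2 * R ^ 2)
    (b := 2 * ((n : ℝ)⁻¹) ^ 2) (by positivity) ?_
  · refine hle.trans ?_
    have h1 : 2 * ((n : ℝ)⁻¹) ^ 2 * (n * C) = (n : ℝ)⁻¹ * (2 * C) := by
      field_simp
    have h2 : (n : ℝ)⁻¹ ≤ 1 := inv_le_one_of_one_le₀ hn'
    have h3 : (n : ℝ)⁻¹ * (2 * C) ≤ 1 * (2 * C) := by gcongr
    have h4 := mul_le_mul_of_nonneg_left hD (show 0 ≤ 2 * ((n : ℝ)⁻¹) ^ 2 by positivity)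
    linarith
  · intro ω
    obtain ⟨z, hz, hxz⟩ := (hcpt.smul (n : ℝ)).exists_infDist_eq_dist (hne.smul_set)
      (∑ i ∈ Finset.range n, X i ω)
    obtain ⟨y, hy, rfl⟩ := hz
    rw [hxz, dist_eq_norm]
    simp only at *
    set s := ∑ i ∈ Finset.range n, X i ω
    have h1 : ‖(n : ℝ)⁻¹ • s - y‖ = (n : ℝ)⁻¹ * ‖s - (n : ℝ) • y‖ := by
      rw [← norm_smul_of_nonneg (by positivity), smul_sub, inv_smul_smul₀ (by positivity)]
    have h2 : ‖(n : ℝ)⁻¹ • s‖ ≤ (n : ℝ)⁻¹ * ‖s - (n : ℝ) • y‖ + R := by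
      have h3 := norm_sub_norm_le ((n : ℝ)⁻¹ • s) y
      have := hR y hy
      linarith
    have h4 := pow_le_pow_left₀ (norm_nonneg _) h2 2
    nlinarith [sq_nonneg ((n : ℝ)⁻¹ * ‖s - (n : ℝ) • y‖ - R)]

/-- The upper bound compares `S_n / n` with a nearest point of `Γ`, the lower bound with a maximizer
of `g` on `Γ`. -/
theorem IsConvolutionary.abs_E_average_sub_le (hX : ∀ i, S.IsRandomVector (X i))
    (hid : ∀ i, IdentDistributed S S (X i) (X 0)) (hconv : S.IsConvolutionary X)
    (hcl : IsClosed Γ) (hcvx : Convex ℝ Γ) (hR : ∀ v ∈ Γ, ‖v‖ ≤ R)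
    (hG : ∀ p, IsGreatest ((fun v => inner ℝ p v) '' Γ) (S.E (fun ω => inner ℝ p (X 0 ω))))
    {K : NNReal} {g : EuclideanSpace ℝ (Fin d) → ℝ} (hg : LipschitzWith K g) {M : ℝ}
    (hM : IsGreatest (g '' Γ) M) {n : ℕ} (hn : 0 < n) {ε : ℝ} (hε : 0 < ε) :
    |S.E (fun ω => g ((n : ℝ)⁻¹ • ∑ i ∈ Finset.range n, X i ω)) - M| ≤
      K * (ε + (2 * R ^ 2 + 2 * S.E (fun ω => ‖X 0 ω‖ ^ 2)) / (ε * n)) := by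
  have hne : Γ.Nonempty := (hG 0).1.imp fun v hv => hv.1
  have hcpt : IsCompact Γ := Metric.isCompact_of_isClosed_isBounded hcl
    (isBounded_iff_forall_norm_le.2 ⟨R, hR⟩)
  have hSn := IsRandomVector.sum_range hX n
  have hn' : (0 : ℝ) < n := by exact_mod_cast hn
  have hK : (0 : ℝ) ≤ K := K.2
  have hgm := S.comp_vec_mem (hSn.const_smul (n : ℝ)⁻¹) (LocLip.of_lipschitzWith hg)
  have hdist : ∀ s y : EuclideanSpace ℝ (Fin d), |g ((n : ℝ)⁻¹ • s) - g y| ≤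
      K * ε + K / (ε * n ^ 2) * ‖s - (n : ℝ) • y‖ ^ 2 := fun s y => by
    have h1 : ‖(n : ℝ)⁻¹ • s - y‖ = (n : ℝ)⁻¹ * ‖s - (n : ℝ) • y‖ := by
      rw [← norm_smul_of_nonneg (by positivity), smul_sub, inv_smul_smul₀ (by positivity)]
    have h2 := hg.dist_le_mul ((n : ℝ)⁻¹ • s) y
    rw [Real.dist_eq, dist_eq_norm, h1] at h2
    refine h2.trans ?_
    -- This trades a distance for its square, in place of Cauchy-Schwarz.
    have h3 : ∀ t : ℝ, t ≤ ε + t ^ 2 / ε := fun t => by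
      rw [← sub_nonneg]
      have : ε + t ^ 2 / ε - t = ((ε - t / 2) ^ 2 + 3 / 4 * t ^ 2) / ε := by
        field_simp; ring
      rw [this]; positivity
    refine (mul_le_mul_of_nonneg_left (h3 _) hK).trans (le_of_eq ?_)
    field_simp
  have hconst : K * ε + K / (ε * n ^ 2) * (n * (2 * R ^ 2 + 2 * S.E (fun ω => ‖X 0 ω‖ ^ 2))) =
      K * (ε + (2 * R ^ 2 + 2 * S.E (fun ω => ‖X 0 ω‖ ^ 2)) / (ε * n)) := by
    field_simp
  have hb : 0 ≤ K / (ε * n ^ 2) := by positivity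
  rw [← hconst, abs_sub_le_iff]
  constructor
  · have hD := hconv.E_infDist_sq_le hX hid hcl hcvx hR hG n
    have hdm : (fun ω => Metric.infDist (∑ i ∈ Finset.range n, X i ω) ((n : ℝ) • Γ) ^ 2) ∈ S.H :=
      S.comp_vec_mem hSn (LocLip.infDist_sq _)
    have hle := S.E_le_const_add_mul hgm hdm (a := M + K * ε) hb ?_
    · have := mul_le_mul_of_nonneg_left hD hb
      linarith
    · intro ω
      obtain ⟨z, hz, hxz⟩ := (hcpt.smul (n : ℝ)).exists_infDist_eq_dist (hne.smul_set)
        (∑ i ∈ Finset.range n, X i ω)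
      obtain ⟨y, hy, rfl⟩ := hz
      rw [hxz, dist_eq_norm]
      have h1 := (abs_le.1 (hdist (∑ i ∈ Finset.range n, X i ω) y)).2
      have h2 := hM.2 ⟨y, hy, rfl⟩
      simp only at *
      linarith
  · obtain ⟨v, hv, hgv⟩ := hM.1
    have hD := hconv.le_E_neg_norm_sq hX hid (hR v hv) (fun p => (hG p).2 ⟨v, hv, rfl⟩) n
    have hdm : (fun ω => -‖(∑ i ∈ Finset.range n, X i ω) - (n : ℝ) • v‖ ^ 2) ∈ S.H :=
      S.comp_vec_mem hSn (LocLip.neg_norm_sub_sq _)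
    have hle := S.const_add_mul_le_E hgm hdm (a := M - K * ε) hb ?_
    · have := mul_le_mul_of_nonneg_left hD hb
      linarith
    · intro ω
      have h1 := (abs_le.1 (hdist (∑ i ∈ Finset.range n, X i ω) v)).1
      linarith

end Convolutionary

end SublinearExpectation

/-! ### Lipschitz approximation with quadratic weight. -/

/-- A continuous function of linear growth is approximated by Lipschitz functions (its
inf-convolutions with multiples of the norm), uniformly with respect to the weight `1 + ‖x‖ ^ 2`. -/
theorem exists_lipschitzWith_abs_sub_le {V : Type*} [NormedAddCommGroup V] [ProperSpace V]
    {φ : V → ℝ} (hφ : Continuous φ) {C : ℝ} (hC : ∀ x, |φ x| ≤ C * (1 + ‖x‖)) {ε : ℝ}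
    (hε : 0 < ε) :
    ∃ (K : NNReal) (g : V → ℝ), LipschitzWith K g ∧ ∀ x, |φ x - g x| ≤ ε * (1 + ‖x‖ ^ 2) := by
  have hC0 : 0 ≤ C := by
    have := (abs_nonneg _).trans (hC 0)
    simpa using this
  -- beyond radius `r` the linear growth is absorbed by the quadratic weight
  set r : ℝ := 4 * C / ε + 1 with hr
  have hr1 : 1 ≤ r := by
    have : 0 ≤ 4 * C / ε := by positivity
    linarith
  obtain ⟨δ, hδ, hunif⟩ := Metric.uniformContinuousOn_iff.1
    ((isCompact_closedBall (0 : V) (r + 1)).uniformContinuousOn_of_continuous hφ.continuousOn) ε hε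
  -- The cap `1` keeps points near `x` inside the ball of radius `r + 1`.
  set δ' := min δ 1 with hδ'
  have hδ'0 : 0 < δ' := lt_min hδ one_pos
  -- `C` pays for the growth of `φ y`; the last term contributes `2 C (1 + r)` once `‖x - y‖ ≥ δ'`,
  -- so distant `y` never undercut `φ x`.
  set N : ℝ := C + 1 + 2 * C * (1 + r) / δ' with hN
  have hNC : C ≤ N := by
    have : 0 ≤ 2 * C * (1 + r) / δ' := by positivity
    linarith
  have hN0 : 0 ≤ N := hC0.trans hNC
  have hlow : ∀ x y, -(C * (1 + ‖x‖)) ≤ φ y + N * ‖x - y‖ := fun x y => by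
    have h1 := (abs_le.1 (hC y)).1
    have h2 : ‖y‖ ≤ ‖x‖ + ‖x - y‖ := by
      have := norm_sub_norm_le y x
      rw [norm_sub_rev] at this
      linarith
    have h3 : C * (1 + ‖y‖) ≤ C * (1 + (‖x‖ + ‖x - y‖)) := by gcongr
    have h4 : C * ‖x - y‖ ≤ N * ‖x - y‖ := by gcongr
    linarith
  have hbdd : ∀ x, BddBelow (Set.range fun y => φ y + N * ‖x - y‖) := fun x =>
    ⟨-(C * (1 + ‖x‖)), by rintro _ ⟨y, rfl⟩; exact hlow x y⟩
  refine ⟨⟨N, hN0⟩, fun x => ⨅ y, φ y + N * ‖x - y‖, ?_, fun x => ?_⟩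
  · refine LipschitzWith.of_le_add_mul _ fun x z => ?_
    rw [← sub_le_iff_le_add]
    refine le_ciInf fun y => ?_
    rw [sub_le_iff_le_add]
    refine (ciInf_le (hbdd x) y).trans ?_
    have h1 : ‖x - y‖ ≤ ‖z - y‖ + dist x z := by
      rw [dist_eq_norm]
      have := norm_add_le (z - y) (x - z)
      rwa [show z - y + (x - z) = x - y by abel] at this
    have h2 : N * ‖x - y‖ ≤ N * (‖z - y‖ + dist x z) := by gcongr
    change φ y + N * ‖x - y‖ ≤ φ y + N * ‖z - y‖ + N * dist x z
    linarith
  · have hle : (⨅ y, φ y + N * ‖x - y‖) ≤ φ x := (ciInf_le (hbdd x) x).trans (by simp)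
    rw [abs_of_nonneg (sub_nonneg.2 hle)]
    rw [sub_le_comm]
    by_cases hx : ‖x‖ ≤ r
    · refine le_ciInf fun y => ?_
      have hw : ε ≤ ε * (1 + ‖x‖ ^ 2) := by nlinarith [sq_nonneg ‖x‖, mul_nonneg hε.le (sq_nonneg ‖x‖)]
      rcases lt_or_ge ‖x - y‖ δ' with hxy | hxy
      · have h1 := hunif x (by simp; linarith) y (by
          have h2 := norm_sub_norm_le y x
          rw [norm_sub_rev] at h2
          have h3 : δ' ≤ 1 := min_le_right _ _
          simp; linarith) (by rw [dist_eq_norm]; exact hxy.trans_le (min_le_left _ _))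
        rw [Real.dist_eq] at h1
        have h2 := (abs_lt.1 h1).2
        have h3 : 0 ≤ N * ‖x - y‖ := by positivity
        linarith
      · have h1 := (abs_le.1 (hC y)).1
        have h1' := (abs_le.1 (hC x)).2
        have h2 : ‖y‖ ≤ ‖x‖ + ‖x - y‖ := by
          have := norm_sub_norm_le y x
          rw [norm_sub_rev] at this
          linarith
        have h3 : C * (1 + ‖y‖) ≤ C * (1 + (r + ‖x - y‖)) := by gcongr; linarith
        have h4 : C * (1 + ‖x‖) ≤ C * (1 + r) := by gcongr
        have h5 : 2 * C * (1 + r) ≤ 2 * C * (1 + r) / δ' * ‖x - y‖ := by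
          calc 2 * C * (1 + r) = 2 * C * (1 + r) / δ' * δ' := by field_simp
            _ ≤ _ := by gcongr
        have h6 : N * ‖x - y‖ = C * ‖x - y‖ + ‖x - y‖ + 2 * C * (1 + r) / δ' * ‖x - y‖ := by
          rw [hN]; ring
        have := norm_nonneg (x - y)
        linarith
    · push Not at hx
      -- Crude bounds suffice here: the gap is at most `2 C (1 + ‖x‖) ≤ 4 C ‖x‖ ≤ ε ‖x‖^2`.
      have h0 : -(C * (1 + ‖x‖)) ≤ ⨅ y, φ y + N * ‖x - y‖ := le_ciInf (hlow x)
      have h1 := (abs_le.1 (hC x)).2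
      have h2 : 4 * C ≤ ε * ‖x‖ := by
        have h3 : 4 * C / ε ≤ ‖x‖ := by linarith
        rw [div_le_iff₀ hε] at h3
        linarith
      have h4 : 1 ≤ ‖x‖ := by linarith
      have h5 : 4 * C * ‖x‖ ≤ ε * ‖x‖ * ‖x‖ := by gcongr
      have h6 : C * 1 ≤ C * ‖x‖ := by gcongr
      nlinarith

/-! ### Existence of the maximal distribution, and membership in the completion. -/

namespace SublinearExpectation

/-- The sublinear expectation `f ↦ max_Γ f` on continuous functions, for `Γ` compact. -/
noncomputable def ofCompact {V : Type*} [TopologicalSpace V] [MeasurableSpace V]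
    [OpensMeasurableSpace V] (Γ : Set V) (hΓ : IsCompact Γ) (hne : Γ.Nonempty) :
    SublinearExpectation V where
  H := {f | Continuous f}
  E f := sSup (f '' Γ)
  measurable_of_mem _ hf := Continuous.measurable hf
  comp_mem n X hX φ hφ := by
    have hX' : ∀ i, Continuous (X i) := hX
    exact hφ.continuous.comp ((PiLp.continuous_toLp 2 _).comp (continuous_pi hX'))
  mono X hX Y hY h := by
    refine csSup_le (hne.image Y) ?_
    rintro _ ⟨x, hx, rfl⟩
    exact (h x).trans (le_csSup (hΓ.image hX).bddAbove ⟨x, hx, rfl⟩)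
  const c := by simp [hne.image_const]
  subadd X hX Y hY := by
    refine csSup_le (hne.image _) ?_
    rintro _ ⟨x, hx, rfl⟩
    exact add_le_add (le_csSup (hΓ.image hX).bddAbove ⟨x, hx, rfl⟩)
      (le_csSup (hΓ.image hY).bddAbove ⟨x, hx, rfl⟩)
  posHom c hc X hX := by
    have hne' := (hne.image X)
    have hbdd := (hΓ.image hX).bddAbove
    rw [(Monotone.map_csSup_of_continuousAt (f := fun t : ℝ => c * t) (by fun_prop)
      (monotone_mul_left_of_nonneg hc) hne' hbdd :), Set.image_image]

theorem ofCompact_isGreatest {V : Type*} [TopologicalSpace V] [MeasurableSpace V]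
    [OpensMeasurableSpace V] {Γ : Set V} (hΓ : IsCompact Γ) (hne : Γ.Nonempty) {f : V → ℝ}
    (hf : Continuous f) : IsGreatest (f '' Γ) ((ofCompact Γ hΓ hne).E f) :=
  (hΓ.image hf).isGreatest_sSup (hne.image f)

variable {Ω : Type*} [MeasurableSpace Ω] (S : SublinearExpectation Ω) {d : ℕ}

/-- By Hahn-Banach, `p ↦ E⟨p, Y⟩` is the support function of a compact convex set. -/
theorem exists_isGreatest_inner {Y : Ω → EuclideanSpace ℝ (Fin d)} (hY : S.IsRandomVector Y) :
    ∃ Γ : Set (EuclideanSpace ℝ (Fin d)), IsCompact Γ ∧ Convex ℝ Γ ∧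
      ∀ p, IsGreatest ((fun v => inner ℝ p v) '' Γ) (S.E (fun ω => inner ℝ p (Y ω))) := by
  have hin : ∀ p, (fun ω => inner ℝ p (Y ω)) ∈ S.H := fun p =>
    S.comp_vec_mem hY (LocLip.inner_right p)
  set G : EuclideanSpace ℝ (Fin d) → ℝ := fun p => S.E (fun ω => inner ℝ p (Y ω)) with hGdef
  have hGhom : ∀ c : ℝ, 0 ≤ c → ∀ p, G (c • p) = c * G p := fun c hc p => by
    simp only [hGdef, ← S.posHom c hc _ (hin p), real_inner_smul_left]
  have hGadd : ∀ p q, G (p + q) ≤ G p + G q := fun p q => by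
    simp only [hGdef, inner_add_left]
    exact S.subadd _ (hin p) _ (hin q)
  have hG0 : G 0 = 0 := by simp [hGdef, S.const]
  have hcl : IsClosed {v : EuclideanSpace ℝ (Fin d) | ∀ p, inner ℝ p v ≤ G p} := by
    simp only [Set.ofPred_forall]
    exact isClosed_iInter fun p => isClosed_le (by fun_prop) continuous_const
  refine ⟨{v | ∀ p, inner ℝ p v ≤ G p}, Metric.isCompact_of_isClosed_isBounded hcl ?_, ?_, ?_⟩
  · have hnm : (fun ω => ‖Y ω‖) ∈ S.H := by
      simpa using S.comp_vec_mem hY (LocLip.norm_pow 1)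
    refine isBounded_iff_forall_norm_le.2 ⟨S.E (fun ω => ‖Y ω‖), fun v hv => ?_⟩
    -- Testing at `p = v` gives `‖v‖^2 ≤ ‖v‖ E‖Y‖`.
    have h1 := hv v
    have h2 := S.E_le_const_add_mul (hin v) hnm (a := 0) (norm_nonneg v)
      (fun ω => by rw [zero_add]; exact real_inner_le_norm v (Y ω))
    rw [real_inner_self_eq_norm_mul_norm] at h1
    rcases (norm_nonneg v).eq_or_lt with h0 | h0
    · rw [← h0]
      exact S.E_nonneg hnm fun ω => norm_nonneg _
    · refine le_of_mul_le_mul_left ?_ h0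
      linarith
  · intro v hv w hw a b ha hb hab p
    rw [inner_add_right, real_inner_smul_right, real_inner_smul_right]
    have h1 := mul_le_mul_of_nonneg_left (hv p) ha
    have h2 := mul_le_mul_of_nonneg_left (hw p) hb
    calc _ ≤ a * G p + b * G p := add_le_add h1 h2
      _ = G p := by rw [← add_mul, hab, one_mul]
  · intro p
    refine ⟨?_, by rintro _ ⟨v, hv, rfl⟩; exact hv p⟩
    have hkey : ∀ c : ℝ, c • p = 0 → c • G p = 0 := fun c hc => by
      rcases smul_eq_zero.1 hc with rfl | rfl
      · simp
      · simp [hG0]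
    -- The functional `c p ↦ c G(p)` on the line through `p` extends to a linear `f ≤ G`; its Riesz
    -- vector lies in the set and attains `G p`.
    obtain ⟨f, hf, hfG⟩ := exists_extension_of_le_sublinear
      (LinearPMap.mkSpanSingleton' p (G p) hkey) G (fun c hc x => hGhom c hc.le x) hGadd (by
        rintro ⟨x, hx⟩
        obtain ⟨c, rfl⟩ := Submodule.mem_span_singleton.1 hx
        rw [LinearPMap.mkSpanSingleton'_apply, smul_eq_mul]
        rcases le_total 0 c with hc | hc
        · exact (hGhom c hc p).ge
        -- For negative `c`, use `0 = G 0 ≤ G(c p) + G(-c p)`.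
        · have h1 := hGadd (c • p) ((-c) • p)
          rw [hGhom (-c) (by linarith), neg_smul, add_neg_cancel, hG0] at h1
          change c * G p ≤ G (c • p)
          linarith)
    set v := (InnerProductSpace.toDual ℝ (EuclideanSpace ℝ (Fin d))).symm
      (LinearMap.toContinuousLinearMap f) with hv
    have hfv : ∀ q, inner ℝ q v = f q := fun q => by
      rw [real_inner_comm, hv, InnerProductSpace.toDual_symm_apply]; rfl
    refine ⟨v, fun q => (hfv q).trans_le (hfG q), ?_⟩
    change inner ℝ p v = G p
    rw [hfv]
    have h1 := hf ⟨p, Submodule.mem_span_singleton_self p⟩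
    have h2 := LinearPMap.mkSpanSingleton'_apply (σ := RingHom.id ℝ) p (G p) hkey (1 : ℝ) (by
      rw [one_smul]; exact Submodule.mem_span_singleton_self p)
    simp only [one_smul] at h2
    exact h1.trans (by simpa using h2)

/-- If `φ` is `ε`-close to the Lipschitz function `g` with weight `1 + ‖x‖ ^ 2`, then `g(Y)` is an
approximation of `φ(Y)` in the sense of the completion. -/
theorem approx_of_lipschitzWith {Y : Ω → EuclideanSpace ℝ (Fin d)} (hY : S.IsRandomVector Y)
    {φ g : EuclideanSpace ℝ (Fin d) → ℝ} {K : NNReal} (hg : LipschitzWith K g) {ε : ℝ}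
    (hε : 0 < ε) (hφg : ∀ x, |φ x - g x| ≤ ε * (1 + ‖x‖ ^ 2)) {M : ℝ}
    (hM : S.E (fun ω => ‖Y ω‖ ^ 2) ≤ M) :
    (fun ω => g (Y ω)) ∈ S.H ∧ ∃ h ∈ S.H, (∀ ω, |φ (Y ω) - g (Y ω)| ≤ h ω) ∧
      S.E h ≤ ε * (1 + M) := by
  have hsq := S.norm_sq_mem hY
  have hmem := S.smul_mem ε (S.add_mem (S.const_mem 1) hsq)
  refine ⟨S.comp_vec_mem hY (LocLip.of_lipschitzWith hg), _, hmem, fun ω => hφg (Y ω), ?_⟩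
  refine (S.E_le_const_add_mul hmem hsq (a := ε) hε.le fun ω => by linarith).trans ?_
  have := mul_le_mul_of_nonneg_left hM hε.le
  linarith

theorem inCompletion_comp {Y : Ω → EuclideanSpace ℝ (Fin d)} (hY : S.IsRandomVector Y)
    {φ : EuclideanSpace ℝ (Fin d) → ℝ} (hφ : Continuous φ) {C : ℝ}
    (hC : ∀ x, |φ x| ≤ C * (1 + ‖x‖)) : S.InCompletion (fun ω => φ (Y ω)) := by
  intro ε hε
  have hM := S.E_nonneg (S.norm_sq_mem hY) fun ω => by positivity
  set M := S.E (fun ω => ‖Y ω‖ ^ 2) with hMdef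
  obtain ⟨K, g, hg, hφg⟩ := exists_lipschitzWith_abs_sub_le hφ hC
    (show 0 < ε / (1 + M) by positivity)
  obtain ⟨h1, h, hh, h2, h3⟩ := S.approx_of_lipschitzWith hY hg (by positivity) hφg le_rfl
  refine ⟨_, h1, h, hh, h2, h3.trans (le_of_eq ?_)⟩
  rw [← hMdef]
  field_simp

end SublinearExpectation

/-! ### The weak law of large numbers. -/

theorem mainTheorem2 {Ω : Type u} [MeasurableSpace Ω] (S : SublinearExpectation Ω) (d : ℕ)
    (X : ℕ → Ω → EuclideanSpace ℝ (Fin d))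
    (hX : ∀ i, S.IsRandomVector (X i))
    (hid : ∀ i, IdentDistributed S S (X i) (X 0))
    (hconv : S.IsConvolutionary X) :
    (∃ (S' : SublinearExpectation (EuclideanSpace ℝ (Fin d)))
        (η : EuclideanSpace ℝ (Fin d) → EuclideanSpace ℝ (Fin d)),
      S'.IsRandomVector η ∧ S'.IsMaximal η ∧
        ∀ p, S'.E (fun ω => inner ℝ p (η ω)) = S.E (fun ω => inner ℝ p (X 0 ω))) ∧
    ∀ (Ω' : Type v) [MeasurableSpace Ω'] (S' : SublinearExpectation Ω')
      (η : Ω' → EuclideanSpace ℝ (Fin d)),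
      S'.IsRandomVector η → S'.IsMaximal η →
      (∀ p, S'.E (fun ω => inner ℝ p (η ω)) = S.E (fun ω => inner ℝ p (X 0 ω))) →
      ∀ φ : EuclideanSpace ℝ (Fin d) → ℝ, Continuous φ →
        (∃ C : ℝ, ∀ x, |φ x| ≤ C * (1 + ‖x‖)) →
        (∀ n : ℕ, S.InCompletion (fun ω => φ ((n : ℝ)⁻¹ • ∑ i ∈ Finset.range n, X i ω))) ∧
        S'.InCompletion (fun ω => φ (η ω)) ∧
        Tendsto (fun n : ℕ => S.expect (fun ω => φ ((n : ℝ)⁻¹ • ∑ i ∈ Finset.range n, X i ω)))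
          atTop (𝓝 (S'.expect (fun ω => φ (η ω)))) := by
  refine ⟨?_, ?_⟩
  · obtain ⟨Γ, hcpt, hcvx, hG⟩ := S.exists_isGreatest_inner (hX 0)
    have hne : Γ.Nonempty := (hG 0).1.imp fun v hv => hv.1
    refine ⟨SublinearExpectation.ofCompact Γ hcpt hne, id, fun i => ?_, ?_, fun p => ?_⟩
    · change Continuous fun x : EuclideanSpace ℝ (Fin d) => x i
      fun_prop
    · exact ⟨Γ, hcpt.isBounded, hcpt.isClosed, hcvx, fun φ hφ =>
        SublinearExpectation.ofCompact_isGreatest hcpt hne hφ.continuous⟩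
    · exact (SublinearExpectation.ofCompact_isGreatest hcpt hne
        (LocLip.inner_right p).continuous).unique (hG p)
  intro Ω' _ S' η hη hmax hchar φ hφ ⟨C, hC⟩
  have hY : ∀ n : ℕ, S.IsRandomVector
      (fun ω => (n : ℝ)⁻¹ • ∑ i ∈ Finset.range n, X i ω) := fun n =>
    (SublinearExpectation.IsRandomVector.sum_range hX n).const_smul _
  refine ⟨fun n => S.inCompletion_comp (hY n) hφ hC, S'.inCompletion_comp hη hφ hC, ?_⟩
  obtain ⟨Γ, hbd, hcl, hcvx, hΓ⟩ := hmax
  obtain ⟨R, hR⟩ := isBounded_iff_forall_norm_le.1 hbd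
  -- Linear functions are test functions, so the set belonging to `η` itself has support function
  -- `G`; no uniqueness of `Γ` is needed.
  have hG : ∀ p, IsGreatest ((fun v => inner ℝ p v) '' Γ) (S.E (fun ω => inner ℝ p (X 0 ω))) :=
    fun p => hchar p ▸ hΓ _ (LocLip.inner_right p)
  set A := S.E (fun ω => ‖X 0 ω‖ ^ 2)
  have hA : 0 ≤ A := S.E_nonneg (S.norm_sq_mem (hX 0)) fun ω => by positivity
  set B := 2 * R ^ 2 + 2 * A with hB
  have hB0 : 0 ≤ B := by positivity
  have hM := fun n => hconv.E_norm_sq_average_le hX hid hcl hcvx hR hG n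
  set M := 2 * R ^ 2 + 2 * B with hMdef
  have hM0 : 0 ≤ M := by positivity
  set M' := S'.E (fun ω => ‖η ω‖ ^ 2)
  have hM'0 : 0 ≤ M' := S'.E_nonneg (S'.norm_sq_mem hη) fun ω => by positivity
  rw [Metric.tendsto_atTop]
  intro ε hε
  -- With this tolerance the errors for `S_n / n` and for `η` add up to at most `ε / 4`.
  obtain ⟨K, g, hg, hφg⟩ := exists_lipschitzWith_abs_sub_le hφ hC
    (show 0 < ε / (8 * (1 + M + M')) by positivity)
  have hK : (0 : ℝ) ≤ K := K.2
  -- Chosen so that `2 K δ ≤ ε / 2`, also when `K = 0`; then `n > B / δ^2` makes the second term of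
  -- the rate at most `δ`.
  set δ := ε / (4 * (1 + K)) with hδdef
  have hδ : 0 < δ := by positivity
  obtain ⟨N, hN⟩ := exists_nat_gt (B / δ ^ 2)
  refine ⟨N + 1, fun n hn => ?_⟩
  have hn0 : 0 < n := by omega
  have hnr : (0 : ℝ) < n := by exact_mod_cast hn0
  have hlim := hconv.abs_E_average_sub_le hX hid hcl hcvx hR hG hg
    (hΓ g (LocLip.of_lipschitzWith hg)) hn0 hδ
  have hsmall : K * (δ + B / (δ * n)) ≤ ε / 2 := by
    have h1 : B / (δ * n) ≤ δ := by
      rw [div_le_iff₀ (by positivity)]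
      have h2 : (N : ℝ) ≤ n := by exact_mod_cast (by omega : N ≤ n)
      have h3 := (hN.trans_le h2).le
      rw [div_le_iff₀ (by positivity)] at h3
      linarith
    calc K * (δ + B / (δ * n)) ≤ (1 + K) * (δ + δ) := by gcongr; linarith
      _ = ε / 2 := by rw [hδdef]; field_simp; ring
  obtain ⟨hg1, h, hh, h1, h2⟩ := S.approx_of_lipschitzWith (hY n) hg (by positivity) hφg (hM n)
  obtain ⟨hg1', h', hh', h1', h2'⟩ := S'.approx_of_lipschitzWith hη hg (by positivity) hφg le_rfl
  have e1 := (S.abs_expect_sub_le hg1 hh h1).trans h2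
  have e2 := (S'.abs_expect_sub_le hg1' hh' h1').trans h2'
  have e3 : ε / (8 * (1 + M + M')) * (1 + M) + ε / (8 * (1 + M + M')) * (1 + M') ≤ ε / 4 := by
    calc _ = ε / (8 * (1 + M + M')) * ((1 + M) + (1 + M')) := by ring
      _ ≤ ε / (8 * (1 + M + M')) * (2 * (1 + M + M')) := by gcongr; linarith
      _ = ε / 4 := by field_simp; norm_num
  have e4 := hlim.trans hsmall
  rw [abs_le] at e1 e2 e4
  rw [Real.dist_eq, abs_lt]
  constructor <;> linarith [e1.1, e1.2, e2.1, e2.2, e4.1, e4.2]
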